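/- Let $\mathcal S$ and $\mathcal A\neq\emptyset$ be finite sets of non-sink states and actions, let $e\notin\mathcal S$ be a sink state, and $\bar{\mathcal S}=\mathcal S\cup\{e\}$. Consider an MDP with transition probabilities $p(s,a,\cdot)$ on $\bar{\mathcal S}$, real rewards $r(s,a,s')$ of arbitrary sign, and initial distribution $\mu$ on $\bar{\mathcal S}$, such that $p(e,a,e)=1$ and $r(e,a,e)=0$ for all $a\in\mathcal A$, $\mu_e=0$, and $\mu_s>0$ for all $s\in\mathcal S$. Let $\Pi_{HR}$, $\Pi_{MD}$, $\Pi_{SD}$ be the sets of history-dependent randomized, Markov deterministic and stationary deterministic policies. Assume that the MDP is transient: $\sum_{t\ge 0}\mathbb P^{\pi,s}[\tilde s_t=s']<\infty$ for all $\pi\in\Pi_{SD}$ and $s,s'\in\mathcal S$. Fix $\beta>0$ and write $\mathrm{ERM}_\beta[X]=-\beta^{-1}\log\mathbb E[e^{-\beta X}]$, for random variables $X$ with values in $[-\infty,\infty]$ (with the conventions $e^{+\infty}=+\infty$, $e^{-\infty}=0$, $0\cdot\infty=0$, $\log(+\infty)=+\infty$, $\log 0=-\infty$). For $t\in\mathbb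 N$, $\pi\in\Pi_{HR}$ and $s\in\bar{\mathcal S}$ define $$v^t_s(\pi)=\mathrm{ERM}^{\pi,s}_\beta\Big[\sum_{k=0}^{t-1}r(\tilde s_k,\tilde a_k,\tilde s_{k+1})\Big],\qquad v^{t,\star}_s=\sup_{\pi\in\Pi_{MD}}v^t_s(\pi),$$ $$v^\infty_s(\pi)=\liminf_{t\to\infty}v^t_s(\pi),\qquad v^{\infty,\star}_s=\liminf_{t\to\infty}v^{t,\star}_s,$$ $$g_t(\pi,\beta)=\mathrm{ERM}^{\pi,\mu}_\beta\Big[\sum_{k=0}^{t}r(\tilde s_k,\tilde a_k,\tilde s_{k+1})\Big],\qquad g_t^\star(\beta)=\sup_{\pi\in\Pi_{HR}}g_t(\pi,\beta),$$ $$g_\infty(\pi,\beta)=\liminf_{t\to\infty}g_t(\pi,\beta),\qquad g_\infty^\star(\beta)=\liminf_{t\to\infty}g_t^\star(\beta),$$ the limits inferior being taken in $[-\infty,\infty]$; the values may be $-\infty$. Then: 1. There is $\pi^\star\in\Pi_{SD}$ with $v^{\infty,\star}_s=v^\infty_s(\pi^\star)$ for all $s\in\bar{\mathcal S}$. 2.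 $$g^\star_\infty(\beta)=\mathrm{ERM}^\mu_\beta\big[v^{\infty,\star}_{\tilde s_0}\big]=\max_{\pi\in\Pi_{SD}}\mathrm{ERM}^\mu_\beta\big[v^\infty_{\tilde s_0}(\pi)\big],$$ the maximum being attained. 3. $\sup_{\pi\in\Pi_{HR}}g_\infty(\pi,\beta)=g^\star_\infty(\beta)$, so the supremum over history-dependent policies of the limiting objective also equals this maximum over stationary deterministic policies. -/

import Mathlib

open scoped ENNReal

noncomputable section

namespace RiskMDP

/-- A Markov decision process with non-sink states `S`, actions `A` and total reward criterion.
The full state space is `Option S`, where `none` is the sink state `e`. -/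
structure MDP (S A : Type*) where
  /-- `p s a` is the distribution of the next state after taking action `a` in state `s`. -/
  p : Option S → A → PMF (Option S)
  /-- `r s a s'` is the reward of the transition from `s` to `s'` under `a`. -/
  r : Option S → A → Option S → ℝ
  /-- The initial state distribution. -/
  μ : PMF (Option S)
  p_sink : ∀ a, p none a none = 1
  r_sink : ∀ a, r none a none = 0
  μ_sink : μ none = 0

/-- Finite histories `s₀, a₀, s₁, a₁, …, s_t` with states in `X` and actions in `A`. -/
inductive History (X A : Type*) where
  | init (s : X) : History X A
  | step (h : History X A) (a : A) (s : X) : History X A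

namespace History

variable {X A : Type*}

/-- The current (last) state `s_t` of the history `s₀, a₀, …, s_t`. -/
def last : History X A → X
  | init s => s
  | step _ _ s => s

/-- The number `t` of transitions in the history `s₀, a₀, …, s_t`. -/
def length : History X A → ℕ
  | init _ => 0
  | step h _ _ => h.length + 1

/-- The total reward `∑_{k<t} r(s_k, a_k, s_{k+1})` of the history `s₀, a₀, …, s_t`. -/
def reward (r : X → A → X → ℝ) : History X A → ℝ
  | init _ => 0
  | step h a s => h.reward r + r h.last a s

end History

/-- History-dependent randomized policies. -/
abbrev HRPolicy (S A : Type*) := History (Option S) A → PMF A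

/-- Markov deterministic policies: a sequence of deterministic decision rules.
The actions chosen in the sink are immaterial. -/
abbrev MDPolicy (S A : Type*) := ℕ → Option S → A

/-- Stationary deterministic policies: a single deterministic decision rule.
The action chosen in the sink is immaterial. -/
abbrev SDPolicy (S A : Type*) := Option S → A

variable {S A : Type*}

/-- A Markov deterministic policy as a history-dependent policy. -/
def MDPolicy.toHR (π : MDPolicy S A) : HRPolicy S A :=
  fun h => PMF.pure (π h.length h.last)

/-- A stationary deterministic policy as a history-dependent policy. -/
def SDPolicy.toHR (d : SDPolicy S A) : HRPolicy S A :=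
  fun h => PMF.pure (d h.last)

/-- The entropic risk measure `-β⁻¹ log E[exp (-β X)]` of an extended-real random variable `X`
on a discrete probability space, with `exp (-β (-∞)) = +∞`, `exp (-β (+∞)) = 0`,
`log (+∞) = +∞` and `log 0 = -∞`. -/
def erm {Ω : Type*} (β : ℝ) (P : PMF Ω) (X : Ω → EReal) : EReal :=
  ((-β⁻¹ : ℝ) : EReal) * ENNReal.log (∑' ω, P ω * EReal.exp (((-β : ℝ) : EReal) * X ω))

namespace MDP

variable (M : MDP S A)

/-- The law of the history `s̃₀, ã₀, …, s̃_t` when `s̃₀` has distribution `ν` and the actions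
follow `π`. -/
def histLaw (π : HRPolicy S A) (ν : PMF (Option S)) : ℕ → PMF (History (Option S) A)
  | 0 => ν.map History.init
  | t + 1 => (histLaw π ν t).bind fun h =>
      (π h).bind fun a => (M.p h.last a).map fun s' => h.step a s'

/-- The law of the state `s̃_t` when `s̃₀` has distribution `ν` and the actions follow `π`. -/
def stateLaw (π : HRPolicy S A) (ν : PMF (Option S)) (t : ℕ) : PMF (Option S) :=
  (M.histLaw π ν t).map History.last

/-- Every stationary deterministic policy visits each non-sink state a finite expected number
of times, from every non-sink initial state. -/
def IsTransient : Prop :=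
  ∀ (d : SDPolicy S A) (s s' : S),
    ∑' t : ℕ, M.stateLaw d.toHR (PMF.pure (some s)) t (some s') < ∞

/-- The initial distribution charges every non-sink state. -/
def PositiveInitial : Prop := ∀ s : S, 0 < M.μ (some s)

/-- `ERM_β^{π,ν}[∑_{k<t} r(s̃_k, ã_k, s̃_{k+1})]`. -/
def ermReturn (β : ℝ) (π : HRPolicy S A) (ν : PMF (Option S)) (t : ℕ) : EReal :=
  erm β (M.histLaw π ν t) fun h => ((h.reward M.r : ℝ) : EReal)

/-- `g_t(π, β)`, the ERM of the return `∑_{k=0}^{t} r(s̃_k, ã_k, s̃_{k+1})` from `μ`. -/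
def g (β : ℝ) (t : ℕ) (π : HRPolicy S A) : EReal := M.ermReturn β π M.μ (t + 1)

/-- `g_t^⋆(β)`, the supremum of `g_t(π, β)` over history-dependent policies. -/
def gOpt (β : ℝ) (t : ℕ) : EReal := ⨆ π : HRPolicy S A, M.g β t π

/-- `g_∞(π, β)`. -/
def gInf (β : ℝ) (π : HRPolicy S A) : EReal :=
  Filter.liminf (fun t => M.g β t π) Filter.atTop

/-- `g_∞^⋆(β)`. -/
def gInfOpt (β : ℝ) : EReal := Filter.liminf (fun t => M.gOpt β t) Filter.atTop

/-- `v^t_s(π)`, the ERM of the return of the first `t` transitions from `s`. -/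
def v (β : ℝ) (t : ℕ) (π : HRPolicy S A) (s : Option S) : EReal :=
  M.ermReturn β π (PMF.pure s) t

/-- `v^{t,⋆}_s`, the best value of `v^t_s(π)` over Markov deterministic policies. -/
def vOpt (β : ℝ) (t : ℕ) (s : Option S) : EReal := ⨆ π : MDPolicy S A, M.v β t π.toHR s

/-- `v^∞_s(π)`. -/
def vInf (β : ℝ) (π : HRPolicy S A) (s : Option S) : EReal :=
  Filter.liminf (fun t => M.v β t π s) Filter.atTop

/-- `v^{∞,⋆}_s`. -/
def vInfOpt (β : ℝ) (s : Option S) : EReal :=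
  Filter.liminf (fun t => M.vOpt β t s) Filter.atTop

end MDP

end RiskMDP

end

noncomputable section

namespace RiskMDP

open Filter
open scoped ENNReal Topology

/-! Maximizing ERM means minimizing the disutility `E[exp (-β R_t)]`, computed in `[0, ∞]` by
iterating a monotone Bellman operator on the constant 1. Split 1 as `sinkInd + liveInd`. The
iterates of `sinkInd` increase, since the sink is absorbing with zero reward; their limit `optLim`
is a fixed point of `optOp`, and a rule greedy for it attains it (`exists_evalLim_eq_optLim`). It
remains to see that the `liveInd` part does not change the limit. For a stationary rule, transience
makes `evalLim` positive everywhere. Where it is finite, the unabsorbed part of this fixed point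
tends to 0 and dominates a positive multiple of the `liveInd` iterates; where it is infinite, the
absorbed part already diverges (`IsTransient.tendsto_evalOp`). A sandwich extends this to `optOp`.
-/

theorem tsum_bind_mul {X Y : Type*} (P : PMF X) (f : X → PMF Y) (u : Y → ℝ≥0∞) :
    ∑' y, P.bind f y * u y = ∑' x, P x * ∑' y, f x y * u y := by
  simp_rw [PMF.bind_apply, ← ENNReal.tsum_mul_right, ← ENNReal.tsum_mul_left, mul_assoc]
  exact ENNReal.tsum_comm

theorem tsum_pure_mul {X : Type*} (x : X) (u : X → ℝ≥0∞) :
    ∑' y, PMF.pure x y * u y = u x := by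
  rw [tsum_eq_single x]
  · simp
  · intro y hy
    simp [PMF.pure_apply, hy]

theorem tsum_map_mul {X Y : Type*} (P : PMF X) (f : X → Y) (u : Y → ℝ≥0∞) :
    ∑' y, P.map f y * u y = ∑' x, P x * u (f x) := by
  rw [PMF.map, tsum_bind_mul]
  simp_rw [Function.comp_apply, tsum_pure_mul]

/-! ### Certainty equivalents of disutilities. -/

section CertaintyEquivalent

/-- The extended real `-β⁻¹ log x` whose exponential disutility is `x`. -/
def certEquiv (β : ℝ) (x : ℝ≥0∞) : EReal := ((-β⁻¹ : ℝ) : EReal) * ENNReal.log x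

theorem certEquiv_eq_neg (β : ℝ) (x : ℝ≥0∞) :
    certEquiv β x = -ENNReal.log (x ^ β⁻¹) := by
  rw [certEquiv, ENNReal.log_rpow, EReal.coe_neg, EReal.neg_mul]

theorem continuous_certEquiv (β : ℝ) : Continuous (certEquiv β) := by
  simp_rw [funext (certEquiv_eq_neg β)]
  exact continuous_neg.comp (ENNReal.continuous_log.comp ENNReal.continuous_rpow_const)

theorem certEquiv_antitone {β : ℝ} (hβ : 0 < β) : Antitone (certEquiv β) := by
  intro x y h
  simp_rw [certEquiv_eq_neg]
  exact EReal.neg_le_neg_iff.2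
    (ENNReal.log_monotone (ENNReal.rpow_le_rpow h (inv_nonneg.2 hβ.le)))

theorem exp_certEquiv {β : ℝ} (hβ : 0 < β) (x : ℝ≥0∞) :
    EReal.exp (((-β : ℝ) : EReal) * certEquiv β x) = x := by
  rw [certEquiv, ← mul_assoc, ← EReal.coe_mul]
  have h : -β * -β⁻¹ = 1 := by field_simp
  rw [h, EReal.coe_one, one_mul, ENNReal.exp_log]

/-- The tower property of ERM, infinite values included: the inner logarithm cancels against the
outer exponential. -/
theorem erm_certEquiv {Ω : Type*} {β : ℝ} (hβ : 0 < β) (P : PMF Ω) (u : Ω → ℝ≥0∞) :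
    erm β P (fun ω => certEquiv β (u ω)) = certEquiv β (∑' ω, P ω * u ω) := by
  simp_rw [erm, exp_certEquiv hβ]
  rfl

end CertaintyEquivalent

/-! ### Exponential Bellman operators and their limits. -/

namespace MDP

variable {S A : Type*} (M : MDP S A) (β : ℝ)

/-- The expectation of `exp (-β r(s, a, s')) f(s')` over the next state `s'`. -/
def backup (s : Option S) (a : A) (f : Option S → ℝ≥0∞) : ℝ≥0∞ :=
  ∑' s', M.p s a s' * (ENNReal.ofReal (Real.exp (-β * M.r s a s')) * f s')

/-- The exponential Bellman operator of a decision rule. -/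
def evalOp (d : Option S → A) (f : Option S → ℝ≥0∞) (s : Option S) : ℝ≥0∞ :=
  M.backup β s (d s) f

/-- The exponential Bellman optimality operator. -/
def optOp (f : Option S → ℝ≥0∞) (s : Option S) : ℝ≥0∞ := ⨅ a, M.backup β s a f

/-- The indicator function of the sink. -/
def sinkInd : Option S → ℝ≥0∞ := fun s => s.elim 1 fun _ => 0

/-- The indicator function of the non-sink states. -/
def liveInd : Option S → ℝ≥0∞ := fun s => s.elim 0 fun _ => 1

/-- The expectation of `exp (-β R_t) f(s̃_t)` where `R_t` is the return of `t` transitions. -/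
def disutility (π : HRPolicy S A) (ν : PMF (Option S)) (t : ℕ) (f : Option S → ℝ≥0∞) : ℝ≥0∞ :=
  ∑' h, M.histLaw π ν t h * (ENNReal.ofReal (Real.exp (-β * h.reward M.r)) * f h.last)

theorem backup_mono (s : Option S) (a : A) : Monotone (M.backup β s a) := fun _ _ h =>
  ENNReal.tsum_le_tsum fun s' => by gcongr; exact h s'

theorem backup_add (s : Option S) (a : A) (f g : Option S → ℝ≥0∞) :
    M.backup β s a (f + g) = M.backup β s a f + M.backup β s a g := by
  simp [backup, mul_add, ENNReal.tsum_add]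

theorem backup_const_mul (s : Option S) (a : A) (c : ℝ≥0∞) (f : Option S → ℝ≥0∞) :
    M.backup β s a (fun s' => c * f s') = c * M.backup β s a f := by
  simp_rw [backup, ← ENNReal.tsum_mul_left]
  exact tsum_congr fun s' => by ring

theorem backup_sink (a : A) (f : Option S → ℝ≥0∞) : M.backup β none a f = f none := by
  have hp : M.p none a = PMF.pure none := by
    have h := (PMF.apply_eq_one_iff (M.p none a) none).1 (M.p_sink a)
    ext s'
    by_cases hs : s' = none
    · subst hs; simp [M.p_sink]
    · rw [(PMF.apply_eq_zero_iff _ _).2 (by rw [h]; simpa using hs)]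
      simp [PMF.pure_apply, hs]
  rw [backup, hp, tsum_pure_mul]
  simp [M.r_sink]

theorem backup_iSup [Finite S] (s : Option S) (a : A) {f : ℕ → Option S → ℝ≥0∞}
    (hf : Monotone f) :
    M.backup β s a (⨆ n, f n) = ⨆ n, M.backup β s a (f n) := by
  have := Fintype.ofFinite S
  simp_rw [backup, tsum_fintype, iSup_apply, ENNReal.mul_iSup]
  refine ENNReal.finsetSum_iSup_of_monotone fun s' i j h => ?_
  gcongr
  exact hf h s'

theorem evalOp_mono (d : Option S → A) : Monotone (M.evalOp β d) := fun _ _ h s =>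
  M.backup_mono β s (d s) h

theorem optOp_mono : Monotone (M.optOp β) := fun _ _ h s =>
  iInf_mono fun a => M.backup_mono β s a h

theorem optOp_le_evalOp (d : Option S → A) (f : Option S → ℝ≥0∞) :
    M.optOp β f ≤ M.evalOp β d f := fun s => iInf_le _ (d s)

theorem exists_evalOp_eq_optOp [Finite A] [Nonempty A] (f : Option S → ℝ≥0∞) :
    ∃ d : Option S → A, M.evalOp β d f = M.optOp β f := by
  choose d hd using fun s => exists_eq_ciInf_of_finite (f := fun a => M.backup β s a f)
  exact ⟨d, funext hd⟩

theorem evalOp_iterate_add (d : Option S → A) (t : ℕ) (f g : Option S → ℝ≥0∞) :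
    (M.evalOp β d)^[t] (f + g) = (M.evalOp β d)^[t] f + (M.evalOp β d)^[t] g := by
  induction t generalizing f g with
  | zero => rfl
  | succ t ih =>
    have h : M.evalOp β d (f + g) = M.evalOp β d f + M.evalOp β d g :=
      funext fun s => M.backup_add β s (d s) f g
    rw [Function.iterate_succ_apply, h, ih]
    rfl

theorem evalOp_iterate_const_mul (d : Option S → A) (t : ℕ) (c : ℝ≥0∞) (f : Option S → ℝ≥0∞) :
    (M.evalOp β d)^[t] (fun s => c * f s) = fun s => c * (M.evalOp β d)^[t] f s := by
  induction t generalizing f with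
  | zero => rfl
  | succ t ih =>
    have h : M.evalOp β d (fun s => c * f s) = fun s => c * M.evalOp β d f s :=
      funext fun s => M.backup_const_mul β s (d s) c f
    rw [Function.iterate_succ_apply, h, ih]
    rfl

theorem sinkInd_add_liveInd : (sinkInd + liveInd : Option S → ℝ≥0∞) = fun _ => 1 := by
  funext s
  cases s <;> simp [sinkInd, liveInd]

theorem sinkInd_le_evalOp (d : Option S → A) : sinkInd ≤ M.evalOp β d sinkInd := by
  intro s
  cases s
  · exact (M.backup_sink β _ _).ge
  · exact zero_le

theorem sinkInd_le_optOp : sinkInd ≤ M.optOp β sinkInd := by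
  intro s
  cases s
  · exact le_iInf fun a => (M.backup_sink β a _).ge
  · exact zero_le

/-- The limit of the expectations of `exp (-β R_t)` restricted to absorption before time `t`. -/
def evalLim (d : Option S → A) : Option S → ℝ≥0∞ := ⨆ t, (M.evalOp β d)^[t] sinkInd

/-- The limit of the value iterates of the optimality operator from the sink indicator. -/
def optLim : Option S → ℝ≥0∞ := ⨆ t, (M.optOp β)^[t] sinkInd

theorem monotone_evalOp_iterate (d : Option S → A) :
    Monotone fun t => (M.evalOp β d)^[t] sinkInd :=
  (M.evalOp_mono β d).monotone_iterate_of_le_map (M.sinkInd_le_evalOp β d)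

theorem monotone_optOp_iterate : Monotone fun t => (M.optOp β)^[t] sinkInd :=
  (M.optOp_mono β).monotone_iterate_of_le_map (M.sinkInd_le_optOp β)

theorem evalOp_evalLim [Finite S] (d : Option S → A) :
    M.evalOp β d (M.evalLim β d) = M.evalLim β d := by
  conv_rhs => rw [evalLim, ← (M.monotone_evalOp_iterate β d).iSup_nat_add 1]
  funext s
  simp_rw [evalOp, evalLim, M.backup_iSup β s (d s) (M.monotone_evalOp_iterate β d), iSup_apply,
    Function.iterate_succ_apply']
  rfl

/-- An infimum over finitely many actions commutes with an increasing supremum. -/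
theorem optOp_optLim [Finite S] [Finite A] :
    M.optOp β (M.optLim β) = M.optLim β := by
  conv_rhs => rw [optLim, ← (M.monotone_optOp_iterate β).iSup_nat_add 1]
  funext s
  simp_rw [optOp, optLim, M.backup_iSup β s _ (M.monotone_optOp_iterate β), iSup_apply,
    Function.iterate_succ_apply']
  exact (iSup_iInf_of_monotone fun a =>
    (M.backup_mono β s a).comp (M.monotone_optOp_iterate β)).symm

theorem optOp_iterate_le_evalOp_iterate (d : Option S → A) (t : ℕ) (f : Option S → ℝ≥0∞) :
    (M.optOp β)^[t] f ≤ (M.evalOp β d)^[t] f :=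
  (M.optOp_mono β).iterate_le_of_le (M.optOp_le_evalOp β d) t f

theorem optLim_le_evalLim (d : Option S → A) : M.optLim β ≤ M.evalLim β d :=
  iSup_mono fun t => M.optOp_iterate_le_evalOp_iterate β d t sinkInd

theorem sinkInd_le_optLim : sinkInd ≤ M.optLim β :=
  le_iSup (fun t => (M.optOp β)^[t] sinkInd) 0

/-- A greedy decision rule for the limit of value iteration attains it. -/
theorem exists_evalLim_eq_optLim [Finite S] [Finite A] [Nonempty A] :
    ∃ d : Option S → A, M.evalLim β d = M.optLim β := by
  obtain ⟨d, hd⟩ := M.exists_evalOp_eq_optOp β (M.optLim β)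
  rw [M.optOp_optLim β] at hd
  refine ⟨d, le_antisymm (iSup_le fun t => ?_) (M.optLim_le_evalLim β d)⟩
  -- `optLim` is fixed by the greedy operator and dominates the starting point `sinkInd`.
  calc (M.evalOp β d)^[t] sinkInd ≤ (M.evalOp β d)^[t] (M.optLim β) :=
        (M.evalOp_mono β d).iterate t (M.sinkInd_le_optLim β)
    _ = M.optLim β := Function.iterate_fixed hd t

/-! ### Finite horizon: disutilities of policies and backward induction. -/

section Disutility

variable (π : HRPolicy S A) (ν : PMF (Option S))

theorem length_eq_of_histLaw_ne_zero {t : ℕ} {h : History (Option S) A}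
    (hh : M.histLaw π ν t h ≠ 0) : h.length = t := by
  induction t generalizing h with
  | zero =>
    obtain ⟨s, -, rfl⟩ := (PMF.mem_support_map_iff _ _ _).1 ((PMF.mem_support_iff _ _).2 hh)
    rfl
  | succ t ih =>
    obtain ⟨h', hh', hm⟩ := (PMF.mem_support_bind_iff _ _ _).1 ((PMF.mem_support_iff _ _).2 hh)
    obtain ⟨a, -, hm⟩ := (PMF.mem_support_bind_iff _ _ _).1 hm
    obtain ⟨s, -, rfl⟩ := (PMF.mem_support_map_iff _ _ _).1 hm
    exact congrArg (· + 1) (ih hh')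

theorem disutility_zero (f : Option S → ℝ≥0∞) :
    M.disutility β π ν 0 f = ∑' s, ν s * f s := by
  rw [disutility, histLaw, tsum_map_mul]
  simp [History.reward, History.last]

theorem disutility_succ (t : ℕ) (f : Option S → ℝ≥0∞) :
    M.disutility β π ν (t + 1) f = ∑' h, M.histLaw π ν t h *
      (ENNReal.ofReal (Real.exp (-β * h.reward M.r)) *
        ∑' a, π h a * M.backup β h.last a f) := by
  rw [disutility, histLaw, tsum_bind_mul]
  refine tsum_congr fun h => ?_
  congr 1
  rw [tsum_bind_mul, ← ENNReal.tsum_mul_left]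
  refine tsum_congr fun a => ?_
  rw [tsum_map_mul, mul_left_comm]
  congr 1
  rw [backup, ← ENNReal.tsum_mul_left]
  refine tsum_congr fun s' => ?_
  rw [History.reward, History.last, mul_add, Real.exp_add,
    ENNReal.ofReal_mul (Real.exp_pos _).le]
  ring

theorem disutility_optOp_le (t : ℕ) (f : Option S → ℝ≥0∞) :
    M.disutility β π ν t (M.optOp β f) ≤ M.disutility β π ν (t + 1) f := by
  rw [disutility_succ]
  refine ENNReal.tsum_le_tsum fun h => ?_
  gcongr
  calc M.optOp β f h.last = ∑' a, π h a * M.optOp β f h.last := by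
        rw [ENNReal.tsum_mul_right, PMF.tsum_coe, one_mul]
    _ ≤ _ := ENNReal.tsum_le_tsum fun a => by gcongr; exact iInf_le _ a

/-- The induction peels off the last decision, whose randomized average is at least the minimum over
actions; hence `f` must vary. -/
theorem le_disutility (t : ℕ) (f : Option S → ℝ≥0∞) :
    ∑' s, ν s * (M.optOp β)^[t] f s ≤ M.disutility β π ν t f := by
  induction t generalizing f with
  | zero => rw [disutility_zero]; rfl
  | succ t ih => exact (ih (M.optOp β f)).trans (M.disutility_optOp_le β π ν t f)

theorem disutility_toHR_succ (π : MDPolicy S A) (t : ℕ) (f : Option S → ℝ≥0∞) :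
    M.disutility β π.toHR ν (t + 1) f = M.disutility β π.toHR ν t (M.evalOp β (π t) f) := by
  rw [disutility_succ, disutility]
  refine tsum_congr fun h => ?_
  by_cases hh : M.histLaw π.toHR ν t h = 0
  · simp [hh]
  · rw [MDPolicy.toHR, tsum_pure_mul, M.length_eq_of_histLaw_ne_zero _ ν hh]
    rfl

theorem disutility_stationary (d : SDPolicy S A) (t : ℕ) (f : Option S → ℝ≥0∞) :
    M.disutility β d.toHR ν t f = ∑' s, ν s * (M.evalOp β d)^[t] f s := by
  induction t generalizing f with
  | zero => rw [disutility_zero]; rfl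
  | succ t ih =>
    have h : d.toHR = MDPolicy.toHR fun _ => d := rfl
    rw [h, disutility_toHR_succ, ← h, ih]
    rfl

/-- Backward induction: some Markov deterministic policy is optimal for a given horizon,
simultaneously for all initial distributions. -/
theorem exists_disutility_eq [Finite A] [Nonempty A] (t : ℕ) (f : Option S → ℝ≥0∞) :
    ∃ π : MDPolicy S A, ∀ ν : PMF (Option S),
      M.disutility β π.toHR ν t f = ∑' s, ν s * (M.optOp β)^[t] f s := by
  choose G hG using M.exists_evalOp_eq_optOp β
  -- After the decision at time `k`, `t - (k + 1)` transitions remain.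
  refine ⟨fun k => G ((M.optOp β)^[t - (k + 1)] f), fun ν => ?_⟩
  have key : ∀ k ≤ t, M.disutility β
      (MDPolicy.toHR fun k => G ((M.optOp β)^[t - (k + 1)] f)) ν k ((M.optOp β)^[t - k] f) =
      ∑' s, ν s * (M.optOp β)^[t] f s := by
    intro k
    induction k with
    | zero => intro _; rw [disutility_zero]; rfl
    | succ k ih =>
      intro hk
      rw [disutility_toHR_succ, hG, ← Function.iterate_succ_apply' (M.optOp β),
        show (t - (k + 1)).succ = t - k by lia]
      exact ih (by lia)
  simpa using key t le_rfl

theorem ermReturn_eq (t : ℕ) :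
    M.ermReturn β π ν t = certEquiv β (M.disutility β π ν t fun _ => 1) := by
  rw [ermReturn, erm, certEquiv, disutility]
  simp_rw [← EReal.coe_mul, EReal.exp_coe, mul_one]

end Disutility

/-! ### Transience and convergence from the constant 1. -/

section Transience

variable {M}

/-- Without any absorption the live probabilities sum to 1 at every time, so the total occupation
time would be infinite. -/
theorem IsTransient.exists_stateLaw_none_ne_zero [Finite S] (hT : M.IsTransient)
    (d : SDPolicy S A) (s : S) :
    ∃ t, M.stateLaw d.toHR (PMF.pure (some s)) t none ≠ 0 := by
  by_contra! h
  have := Fintype.ofFinite S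
  have hsum : ∀ t, ∑ s', M.stateLaw d.toHR (PMF.pure (some s)) t (some s') = 1 := fun t => by
    have h1 := (M.stateLaw d.toHR (PMF.pure (some s)) t).tsum_coe
    rwa [tsum_fintype, Fintype.sum_option, h t, zero_add] at h1
  have hlt : ∑ s', ∑' t, M.stateLaw d.toHR (PMF.pure (some s)) t (some s') < ∞ :=
    ENNReal.sum_lt_top.2 fun s' _ => hT d s s'
  rw [← Summable.tsum_finsetSum fun _ _ => ENNReal.summable] at hlt
  simp [hsum] at hlt

theorem stateLaw_none_eq_zero {d : SDPolicy S A} {s : Option S} {t : ℕ}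
    (h : (M.evalOp β d)^[t] sinkInd s = 0) :
    M.stateLaw d.toHR (PMF.pure s) t none = 0 := by
  have h0 := M.disutility_stationary β (PMF.pure s) d t sinkInd
  rw [tsum_pure_mul, h, disutility, ENNReal.tsum_eq_zero] at h0
  rw [PMF.apply_eq_zero_iff, stateLaw, PMF.mem_support_map_iff]
  rintro ⟨x, hx, hlast⟩
  have hw : ENNReal.ofReal (Real.exp (-β * x.reward M.r)) ≠ 0 := by
    simp [Real.exp_pos]
  have h1 := h0 x
  rw [hlast, sinkInd, Option.elim_none, mul_one, mul_eq_zero] at h1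
  exact h1.elim ((PMF.mem_support_iff _ _).1 hx) hw

theorem IsTransient.evalLim_ne_zero [Finite S] (hT : M.IsTransient) (d : SDPolicy S A)
    (s : Option S) : M.evalLim β d s ≠ 0 := by
  intro h
  rw [evalLim, iSup_apply, ENNReal.iSup_eq_zero] at h
  cases s with
  | none => exact one_ne_zero (h 0)
  | some s =>
    obtain ⟨t, ht⟩ := hT.exists_stateLaw_none_ne_zero d s
    exact ht (stateLaw_none_eq_zero β (h t))

/-- Under transience the exponential disutility of a stationary policy converges to
the part collected on absorption, even where both are infinite. -/
theorem IsTransient.tendsto_evalOp [Finite S] (hT : M.IsTransient) (d : SDPolicy S A)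
    (s : Option S) :
    Tendsto (fun t => (M.evalOp β d)^[t] (fun _ => 1) s) atTop (𝓝 (M.evalLim β d s)) := by
  have := Fintype.ofFinite S
  have hsplit : ∀ t, (M.evalOp β d)^[t] (fun _ => 1) s =
      (M.evalOp β d)^[t] sinkInd s + (M.evalOp β d)^[t] liveInd s := fun t => by
    rw [← sinkInd_add_liveInd, evalOp_iterate_add]
    rfl
  have hsink : Tendsto (fun t => (M.evalOp β d)^[t] sinkInd s) atTop
      (𝓝 (M.evalLim β d s)) := by
    rw [evalLim, iSup_apply]
    exact tendsto_atTop_iSup fun i j h => M.monotone_evalOp_iterate β d h s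
  by_cases htop : M.evalLim β d s = ∞
  · rw [htop] at hsink ⊢
    exact tendsto_nhds_top_mono' hsink fun t => by
      rw [hsplit]
      exact le_self_add
  -- The minimum of `evalLim` is positive by transience, and finite because `evalLim` is finite at
  -- `s`.
  obtain ⟨m, hm⟩ := exists_eq_ciInf_of_finite (f := M.evalLim β d)
  have hm0 := hT.evalLim_ne_zero β d m
  -- `rest` may be infinite at other states; only finiteness of `evalLim` at `s` is needed.
  set rest : Option S → ℝ≥0∞ := fun s' => s'.elim 0 fun x => M.evalLim β d (some x) with hrest
  have hnone : M.evalLim β d none = 1 := by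
    have h : ∀ t, (M.evalOp β d)^[t] sinkInd none = 1 := fun t => by
      induction t with
      | zero => rfl
      | succ t ih => rw [Function.iterate_succ_apply', evalOp, backup_sink, ih]
    rw [evalLim, iSup_apply]
    simp [h]
  have hx : sinkInd + rest = M.evalLim β d := by
    funext s'
    cases s' <;> simp [sinkInd, hrest, hnone]
  have hadd : ∀ t, (M.evalOp β d)^[t] sinkInd s + (M.evalOp β d)^[t] rest s =
      M.evalLim β d s := fun t => by
    rw [← Pi.add_apply, ← evalOp_iterate_add, hx,
      Function.iterate_fixed (M.evalOp_evalLim β d)]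
  have hrest0 : Tendsto (fun t => (M.evalOp β d)^[t] rest s) atTop (𝓝 0) := by
    have h1 : Tendsto (fun t => M.evalLim β d s - (M.evalOp β d)^[t] sinkInd s) atTop
        (𝓝 (M.evalLim β d s - M.evalLim β d s)) :=
      ENNReal.Tendsto.sub tendsto_const_nhds hsink (Or.inl htop)
    rw [tsub_self] at h1
    refine h1.congr fun t => ?_
    have hfin : (M.evalOp β d)^[t] sinkInd s ≠ ∞ :=
      ne_top_of_le_ne_top htop (le_self_add.trans (hadd t).le)
    rw [← hadd t, ENNReal.add_sub_cancel_left hfin]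
  have hlive : Tendsto (fun t => (M.evalOp β d)^[t] liveInd s) atTop (𝓝 0) := by
    have h1 : Tendsto (fun t => (M.evalLim β d m)⁻¹ * (M.evalOp β d)^[t] rest s) atTop
        (𝓝 ((M.evalLim β d m)⁻¹ * 0)) :=
      ENNReal.Tendsto.const_mul hrest0 (Or.inr (ENNReal.inv_ne_top.2 hm0))
    rw [mul_zero] at h1
    refine tendsto_of_tendsto_of_tendsto_of_le_of_le tendsto_const_nhds h1
      (fun _ => zero_le) fun t => ?_
    have hle : liveInd ≤ fun s' => (M.evalLim β d m)⁻¹ * rest s' := by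
      intro s'
      cases s' with
      | none => exact zero_le
      | some x =>
        change 1 ≤ (M.evalLim β d m)⁻¹ * M.evalLim β d (some x)
        have hmx : M.evalLim β d m ≤ M.evalLim β d (some x) := hm.trans_le (iInf_le _ _)
        have hmtop : M.evalLim β d m ≠ ∞ := ne_top_of_le_ne_top htop (hm.trans_le (iInf_le _ _))
        rw [← ENNReal.inv_mul_cancel hm0 hmtop]
        gcongr
    have h2 := (M.evalOp_mono β d).iterate t hle s
    rwa [evalOp_iterate_const_mul] at h2
  simpa [hsplit] using hsink.add hlive

theorem IsTransient.tendsto_optOp [Finite S] [Finite A] [Nonempty A] (hT : M.IsTransient)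
    (s : Option S) :
    Tendsto (fun t => (M.optOp β)^[t] (fun _ => 1) s) atTop (𝓝 (M.optLim β s)) := by
  obtain ⟨d, hd⟩ := M.exists_evalLim_eq_optLim β
  have hone : (sinkInd : Option S → ℝ≥0∞) ≤ fun _ => 1 := by
    rw [← sinkInd_add_liveInd]
    exact le_self_add
  -- Squeeze between optimal iterates of `sinkInd` and the greedy rule's iterates of 1.
  refine tendsto_of_tendsto_of_tendsto_of_le_of_le (g := fun t => (M.optOp β)^[t] sinkInd s)
    ?_ (hd ▸ hT.tendsto_evalOp β d s) (fun t => (M.optOp_mono β).iterate t hone s)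
    fun t => M.optOp_iterate_le_evalOp_iterate β d t _ s
  rw [optLim, iSup_apply]
  exact tendsto_atTop_iSup fun i j h => M.monotone_optOp_iterate β h s

end Transience

theorem tendsto_tsum_mul [Finite S] (ν : PMF (Option S)) {u : ℕ → Option S → ℝ≥0∞}
    {w : Option S → ℝ≥0∞} (h : ∀ s, Tendsto (fun t => u t s) atTop (𝓝 (w s))) :
    Tendsto (fun t => ∑' s, ν s * u t s) atTop (𝓝 (∑' s, ν s * w s)) := by
  have := Fintype.ofFinite S
  simp_rw [tsum_fintype]
  exact tendsto_finsetSum _ fun s _ =>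
    ENNReal.Tendsto.const_mul (h s) (Or.inr (ν.apply_ne_top s))

/-! ### Infinite-horizon values in closed form. -/

section Values

variable {M β}

theorem vOpt_eq [Finite A] [Nonempty A] (hβ : 0 < β) (t : ℕ) (s : Option S) :
    M.vOpt β t s = certEquiv β ((M.optOp β)^[t] (fun _ => 1) s) := by
  refine le_antisymm (iSup_le fun π => ?_) ?_
  · rw [v, ermReturn_eq]
    refine certEquiv_antitone hβ ?_
    simpa only [tsum_pure_mul] using M.le_disutility β π.toHR (PMF.pure s) t fun _ => 1
  · obtain ⟨π, hπ⟩ := M.exists_disutility_eq β t fun _ => 1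
    refine le_iSup_of_le π ?_
    rw [v, ermReturn_eq, hπ, tsum_pure_mul]

theorem gOpt_eq [Finite A] [Nonempty A] (hβ : 0 < β) (t : ℕ) :
    M.gOpt β t = certEquiv β (∑' s, M.μ s * (M.optOp β)^[t + 1] (fun _ => 1) s) := by
  refine le_antisymm (iSup_le fun π => ?_) ?_
  · rw [g, ermReturn_eq]
    exact certEquiv_antitone hβ (M.le_disutility β π M.μ (t + 1) fun _ => 1)
  · obtain ⟨π, hπ⟩ := M.exists_disutility_eq β (t + 1) fun _ => 1
    refine le_iSup_of_le π.toHR ?_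
    rw [g, ermReturn_eq, hπ]

theorem IsTransient.vInf_eq [Finite S] (hT : M.IsTransient) (d : SDPolicy S A)
    (s : Option S) : M.vInf β d.toHR s = certEquiv β (M.evalLim β d s) := by
  refine Tendsto.liminf_eq (((continuous_certEquiv β).tendsto _).comp
    (hT.tendsto_evalOp β d s) |>.congr fun t => ?_)
  rw [v, ermReturn_eq, disutility_stationary, tsum_pure_mul]
  rfl

theorem IsTransient.gInf_eq [Finite S] (hT : M.IsTransient) (d : SDPolicy S A) :
    M.gInf β d.toHR = certEquiv β (∑' s, M.μ s * M.evalLim β d s) := by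
  refine Tendsto.liminf_eq (((continuous_certEquiv β).tendsto _).comp
    ((tendsto_tsum_mul M.μ (hT.tendsto_evalOp β d)).comp (tendsto_add_atTop_nat 1))
    |>.congr fun t => ?_)
  rw [g, ermReturn_eq, disutility_stationary]
  rfl

theorem IsTransient.vInfOpt_eq [Finite S] [Finite A] [Nonempty A] (hT : M.IsTransient)
    (hβ : 0 < β) (s : Option S) : M.vInfOpt β s = certEquiv β (M.optLim β s) := by
  refine Tendsto.liminf_eq (((continuous_certEquiv β).tendsto _).comp
    (hT.tendsto_optOp β s) |>.congr fun t => ?_)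
  rw [vOpt_eq hβ]
  rfl

theorem IsTransient.gInfOpt_eq [Finite S] [Finite A] [Nonempty A] (hT : M.IsTransient)
    (hβ : 0 < β) : M.gInfOpt β = certEquiv β (∑' s, M.μ s * M.optLim β s) := by
  refine Tendsto.liminf_eq (((continuous_certEquiv β).tendsto _).comp
    ((tendsto_tsum_mul M.μ (hT.tendsto_optOp β)).comp (tendsto_add_atTop_nat 1))
    |>.congr fun t => ?_)
  rw [gOpt_eq hβ]
  rfl

theorem gInf_le_gInfOpt (π : HRPolicy S A) : M.gInf β π ≤ M.gInfOpt β :=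
  liminf_le_liminf (Eventually.of_forall fun t => le_iSup (M.g β t) π)

end Values

end MDP

end RiskMDP

end

theorem mainTheorem2 {S A : Type*} [Finite S] [Finite A] [Nonempty A]
    (M : RiskMDP.MDP S A) (hT : M.IsTransient) (hμ : M.PositiveInitial)
    (β : ℝ) (hβ : 0 < β) :
    (∃ πstar : RiskMDP.SDPolicy S A, ∀ s : Option S,
      M.vInfOpt β s = M.vInf β πstar.toHR s) ∧
    M.gInfOpt β = RiskMDP.erm β M.μ (fun s => M.vInfOpt β s) ∧
    IsGreatest
      (Set.range fun d : RiskMDP.SDPolicy S A =>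
        RiskMDP.erm β M.μ (fun s => M.vInf β d.toHR s))
      (M.gInfOpt β) ∧
    (⨆ π : RiskMDP.HRPolicy S A, M.gInf β π) = M.gInfOpt β := by
  obtain ⟨d, hd⟩ := M.exists_evalLim_eq_optLim β
  simp_rw [hT.gInfOpt_eq hβ, hT.vInfOpt_eq hβ, hT.vInf_eq, RiskMDP.erm_certEquiv hβ]
  refine ⟨⟨d, fun s => by rw [hd]⟩, trivial, ⟨⟨d, by simp only [hd]⟩, ?_⟩, ?_⟩
  · rintro _ ⟨d', rfl⟩
    exact RiskMDP.certEquiv_antitone hβ (ENNReal.tsum_le_tsum fun s => by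
      gcongr
      exact M.optLim_le_evalLim β d' s)
  · rw [← hT.gInfOpt_eq hβ]
    -- The bound at each horizon passes to the liminf; the greedy stationary rule attains it.
    refine le_antisymm (iSup_le M.gInf_le_gInfOpt) (le_iSup_of_le (RiskMDP.SDPolicy.toHR d) ?_)
    rw [hT.gInf_eq, hT.gInfOpt_eq hβ, hd]
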